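/- Let $\mu$ be a non-degenerate probability distribution on $\mathbb{R}$ (that is, $\mu$ is not a point mass) with finite moments $\mu_k=\int x^k\,d\mu(x)$ of all orders $k=0,1,2,\ldots$. Then the sequence $\{\mu_k/k!\}_{k\ge 0}$ either contains infinitely many different terms or contains at most three different terms. In the latter case there are real numbers $a,b$ with $$b\ge 0,\qquad \frac{1-a-b}{2}\ge 0,\qquad \frac{1+a-b}{2}\ge 0,$$ such that the sequence is $1,a,1-b,a,1-b,a,1-b,\ldots$ (that is, $\mu_0=1$, $\mu_{2k-1}/(2k-1)!=a$ and $\mu_{2k}/(2k)!=1-b$ for all $k\ge 1$), and the characteristic function of $\mu$ is $$f(t)=\int e^{itx}\,d\mu(x)=\frac{1+iat+bt^2}{1+t^2},\qquad t\in\mathbb{R}.$$ -/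

import Mathlib

open MeasureTheory ProbabilityTheory

/-- The normalized moment `μ_k / k!` of a distribution `μ` on the real line,
where `μ_k = ∫ x ^ k dμ(x)`. -/
noncomputable def normalizedMoment (μ : Measure ℝ) (k : ℕ) : ℝ :=
  (∫ x : ℝ, x ^ k ∂μ) / (k.factorial : ℝ)

/-!
Suppose that the normalized moments `c k` take finitely many values, and let `F z = ∫ exp (z x) dμ`.
Since `c` is bounded, `F` is holomorphic on the strip `|Re z| < 1` and `F z = ∑ c k z ^ k` on the unit
disc. Moreover `|F z| ≤ F (Re z) ≤ M / (1 - |Re z|)`, while `|1 - z ^ 2| ^ 2 ≤ 8 (1 - |Re z|)` on the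
disc, so `(1 - z ^ 2) ^ 2 F z` is bounded there (`norm_complexMGF_le`, `norm_one_sub_sq_sq_le`). By
Parseval its Taylor coefficients `c k - 2 c (k - 2) + c (k - 4)` tend to `0`; as they take finitely
many values, they eventually vanish (`tendsto_zero_of_norm_sum_le`,
`eventually_eq_zero_of_finite_range`). A bounded sequence with this property is eventually
2-periodic, so `(1 - z ^ 2) F z` is a polynomial on the disc, hence on the strip by the identity
theorem (`one_sub_sq_mul_complexMGF`). On the imaginary axis `F` is the characteristic function,
bounded by `1`, so this polynomial has degree at most two. This gives both the shape of the sequence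
and the formula for the characteristic function.

For the sign conditions, `1 + a x - b x ^ 2 = (1 - x ^ 2) F x ≥ 0` for real `x` in `(-1, 1)`, and
`x → ±1` gives the two conditions on `1 ± a - b`; and `b` is the limit of the characteristic function
at infinity, which is nonnegative by positive definiteness (`nonneg_of_tendsto_charFun`).
-/

section auxiliary

open Filter Topology Polynomial

/-! ### Bounded power series and polynomials -/

/-- Bessel's inequality for a power series bounded by `C` on the open unit disc: the squared
coefficients sum to at most `C ^ 2`. It is Parseval's identity for the partial sums on the circle of
radius `r`, followed by the limits of long partial sums and of `r → 1`. -/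
theorem sum_sq_norm_le_of_norm_sum_le {h : ℕ → ℂ} {C : ℝ}
    (hs : ∀ r : ℝ, 0 ≤ r → r < 1 → Summable fun n => ‖h n‖ * r ^ n)
    (hb : ∀ z : ℂ, ‖z‖ < 1 → ‖∑' n, h n * z ^ n‖ ≤ C) (N : ℕ) :
    ∑ n ∈ Finset.range N, ‖h n‖ ^ 2 ≤ C ^ 2 := by
  have key : ∀ r : ℝ, 0 ≤ r → r < 1 →
      ∑ n ∈ Finset.range N, (‖h n‖ * r ^ n) ^ 2 ≤ C ^ 2 := by
    intro r hr0 hr1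
    have hsr := hs r hr0 hr1
    -- `ε m` bounds the `m`-th remainder of the series on the circle of radius `r`.
    set ε : ℕ → ℝ := fun m => ∑' n, ‖h (n + m)‖ * r ^ (n + m) with hε
    have hε0 : Tendsto ε atTop (𝓝 0) := tendsto_sum_nat_add fun n => ‖h n‖ * r ^ n
    have hbound : ∀ m, N ≤ m →
        ∑ n ∈ Finset.range N, (‖h n‖ * r ^ n) ^ 2 ≤ (C + ε m) ^ 2 := by
      intro m hm
      let p : ℂ[X] := ∑ n ∈ Finset.range m, monomial n (h n * (r : ℂ) ^ n)
      have hpc : ∀ n, p.coeff n = if n < m then h n * (r : ℂ) ^ n else 0 := by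
        intro n
        simp [p, finsetSum_coeff, coeff_monomial]
      have hpn : ∀ n, n < m → ‖p.coeff n‖ = ‖h n‖ * r ^ n := by
        intro n hn
        rw [hpc, if_pos hn, norm_mul, norm_pow, Complex.norm_real, Real.norm_of_nonneg hr0]
      have hparseval := p.sum_sq_norm_coeff_eq_circleAverage
      have h1 : ∑ n ∈ Finset.range N, (‖h n‖ * r ^ n) ^ 2
          ≤ ∑ i ∈ p.support, ‖p.coeff i‖ ^ 2 := by
        calc ∑ n ∈ Finset.range N, (‖h n‖ * r ^ n) ^ 2
            = ∑ n ∈ Finset.range N, ‖p.coeff n‖ ^ 2 := by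
              refine Finset.sum_congr rfl fun n hn => ?_
              rw [hpn n (lt_of_lt_of_le (Finset.mem_range.1 hn) hm)]
          _ ≤ ∑ n ∈ Finset.range N ∪ p.support, ‖p.coeff n‖ ^ 2 :=
              Finset.sum_le_sum_of_subset_of_nonneg Finset.subset_union_left
                fun _ _ _ => by positivity
          _ = _ := by
              refine (Finset.sum_subset Finset.subset_union_right fun n _ hn => ?_).symm
              rw [Polynomial.notMem_support_iff.1 hn]; simp
      refine h1.trans ?_
      rw [hparseval]
      refine Real.circleAverage_mono_on_of_le_circle ?_ ?_
      · refine ContinuousOn.circleIntegrable (by norm_num) ?_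
        exact Continuous.continuousOn (by fun_prop)
      · intro z hz
        have hz1 : ‖z‖ = 1 := by simpa using hz
        have hrz : ‖(r : ℂ) * z‖ < 1 := by
          rw [norm_mul, hz1, Complex.norm_real, Real.norm_of_nonneg hr0]; simpa using hr1
        have hnt : ∀ n, ‖h n * ((r : ℂ) * z) ^ n‖ = ‖h n‖ * r ^ n := by
          intro n
          rw [norm_mul, norm_pow, norm_mul, hz1, Complex.norm_real, Real.norm_of_nonneg hr0,
            mul_one]
        have hsz : Summable fun n => h n * ((r : ℂ) * z) ^ n :=
          Summable.of_norm (by simpa only [hnt] using hsr)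
        have heval : p.eval z = ∑ n ∈ Finset.range m, h n * ((r : ℂ) * z) ^ n := by
          simp [p, eval_finsetSum, mul_pow, mul_assoc]
        have hsplit := hsz.sum_add_tsum_nat_add m
        have htail : ‖∑' n, h (n + m) * ((r : ℂ) * z) ^ (n + m)‖ ≤ ε m := by
          refine tsum_of_norm_bounded
            ((summable_nat_add_iff (f := fun n => ‖h n‖ * r ^ n) m).2 hsr).hasSum fun n => ?_
          exact (hnt _).le
        have : ‖p.eval z‖ ≤ C + ε m := by
          rw [heval, eq_sub_of_add_eq hsplit]
          exact (norm_sub_le _ _).trans (add_le_add (hb _ hrz) htail)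
        gcongr
    have hlim : Tendsto (fun m => (C + ε m) ^ 2) atTop (𝓝 (C ^ 2)) := by
      simpa using (hε0.const_add C).pow 2
    exact ge_of_tendsto hlim (eventually_atTop.2 ⟨N, hbound⟩)
  have hcont : Tendsto (fun r : ℝ => ∑ n ∈ Finset.range N, (‖h n‖ * r ^ n) ^ 2) (𝓝[<] 1)
      (𝓝 (∑ n ∈ Finset.range N, ‖h n‖ ^ 2)) := by
    have : Continuous fun r : ℝ => ∑ n ∈ Finset.range N, (‖h n‖ * r ^ n) ^ 2 := by fun_prop
    simpa using (this.tendsto 1).mono_left nhdsWithin_le_nhds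
  refine le_of_tendsto hcont ?_
  filter_upwards [Ioo_mem_nhdsLT (show (0 : ℝ) < 1 by norm_num)] with r hr
  exact key r hr.1.le hr.2

theorem tendsto_zero_of_norm_sum_le {h : ℕ → ℂ} {C : ℝ}
    (hs : ∀ r : ℝ, 0 ≤ r → r < 1 → Summable fun n => ‖h n‖ * r ^ n)
    (hb : ∀ z : ℂ, ‖z‖ < 1 → ‖∑' n, h n * z ^ n‖ ≤ C) : Tendsto h atTop (𝓝 0) := by
  have hsum : Summable fun n => ‖h n‖ ^ 2 :=
    summable_of_sum_range_le (fun _ => by positivity) (sum_sq_norm_le_of_norm_sum_le hs hb)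
  rw [tendsto_zero_iff_norm_tendsto_zero]
  simpa using hsum.tendsto_atTop_zero.sqrt

/-- A finite set has no nonzero points close to `0`, so a null sequence in it is eventually `0`. -/
theorem eventually_eq_zero_of_finite_range {u : ℕ → ℂ} (hfin : (Set.range u).Finite)
    (hu : Tendsto u atTop (𝓝 0)) : ∀ᶠ n in atTop, u n = 0 := by
  have hopen : (Set.range u \ {0})ᶜ ∈ 𝓝 (0 : ℂ) :=
    (hfin.subset Set.sdiff_subset).isClosed.isOpen_compl.mem_nhds (by simp)
  filter_upwards [hu hopen] with n hn
  by_contra h0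
  exact hn ⟨⟨n, rfl⟩, h0⟩

/-- A polynomial of growth at most `1 + t ^ 2` along the imaginary axis has degree at most two. -/
theorem coeff_eq_zero_of_norm_eval_mul_I_le {P : ℂ[X]}
    (hP : ∀ t : ℝ, ‖P.eval ((t : ℂ) * Complex.I)‖ ≤ 1 + t ^ 2) (n : ℕ) (hn : 3 ≤ n) :
    P.coeff n = 0 := by
  -- `R` is the quotient of `P` by `X ^ 3`; it tends to `0` along the imaginary axis.
  set R : ℂ[X] := P.divX.divX.divX with hR
  have hPR : ∀ z : ℂ, P.eval z
      = P.coeff 0 + P.coeff 1 * z + P.coeff 2 * z ^ 2 + R.eval z * z ^ 3 := by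
    intro z
    have h1 := congrArg (eval z) P.divX_mul_X_add
    have h2 := congrArg (eval z) P.divX.divX_mul_X_add
    have h3 := congrArg (eval z) P.divX.divX.divX_mul_X_add
    simp only [eval_add, eval_mul, eval_X, eval_C, coeff_divX, zero_add] at h1 h2 h3
    norm_num at h1 h2 h3
    rw [← h1, ← h2, ← h3]; ring
  set A : ℝ := ‖P.coeff 0‖ + ‖P.coeff 1‖ + ‖P.coeff 2‖ + 2 with hA
  have hbound : ∀ t : ℝ, 1 ≤ t → ‖R.eval ((t : ℂ) * Complex.I)‖ ≤ A / t := by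
    intro t ht
    have ht0 : 0 < t := by linarith
    have hz : ‖(t : ℂ) * Complex.I‖ = t := by simp [abs_of_pos ht0]
    have hq : ‖R.eval ((t : ℂ) * Complex.I)‖ * t ^ 3 ≤ A * t ^ 2 := by
      calc ‖R.eval ((t : ℂ) * Complex.I)‖ * t ^ 3
          = ‖R.eval ((t : ℂ) * Complex.I) * ((t : ℂ) * Complex.I) ^ 3‖ := by
            rw [norm_mul, norm_pow, hz]
        _ = ‖P.eval ((t : ℂ) * Complex.I) - P.coeff 0 - P.coeff 1 * ((t : ℂ) * Complex.I)
              - P.coeff 2 * ((t : ℂ) * Complex.I) ^ 2‖ := by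
            rw [hPR]; ring_nf
        _ ≤ (1 + t ^ 2) + ‖P.coeff 0‖ + ‖P.coeff 1‖ * t + ‖P.coeff 2‖ * t ^ 2 := by
            refine (norm_sub_le _ _).trans (add_le_add ((norm_sub_le _ _).trans
              (add_le_add ((norm_sub_le _ _).trans (add_le_add (hP t) le_rfl)) ?_)) ?_)
            · rw [norm_mul, hz]
            · rw [norm_mul, norm_pow, hz]
        _ ≤ A * t ^ 2 := by
            have h1 : 1 ≤ t ^ 2 := by nlinarith
            have h2 : t ≤ t ^ 2 := by nlinarith
            have e0 := mul_le_mul_of_nonneg_left h1 (norm_nonneg (P.coeff 0))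
            have e1 := mul_le_mul_of_nonneg_left h2 (norm_nonneg (P.coeff 1))
            rw [hA]; nlinarith
    rw [le_div_iff₀ ht0]
    have : 0 < t ^ 2 := by positivity
    refine le_of_mul_le_mul_right ?_ this
    linarith [show ‖R.eval ((t : ℂ) * Complex.I)‖ * t * t ^ 2
      = ‖R.eval ((t : ℂ) * Complex.I)‖ * t ^ 3 by ring]
  have hlim : Tendsto (fun t : ℝ => ‖R.eval ((t : ℂ) * Complex.I)‖) atTop (𝓝 0) := by
    refine squeeze_zero' (Eventually.of_forall fun _ => norm_nonneg _)
      ((eventually_ge_atTop 1).mono hbound) ?_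
    exact tendsto_const_nhds.div_atTop tendsto_id
  have hR0 : R = 0 := by
    by_cases hdeg : 0 < R.degree
    · have hz : Tendsto (fun t : ℝ => ‖(t : ℂ) * Complex.I‖) atTop atTop := by
        simpa using tendsto_abs_atTop_atTop
      exact absurd hlim (not_tendsto_nhds_of_tendsto_atTop (R.tendsto_norm_atTop hdeg hz) 0)
    · have hC := eq_C_of_degree_le_zero (not_lt.1 hdeg)
      rw [hC] at hlim ⊢
      simp only [eval_C] at hlim
      have := tendsto_nhds_unique hlim tendsto_const_nhds
      rw [norm_eq_zero.1 this.symm, C_0]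
  obtain ⟨m, rfl⟩ := Nat.exists_eq_add_of_le' hn
  have : R.coeff m = P.coeff (m + 3) := by simp [hR, coeff_divX]
  rw [← this, hR0, coeff_zero]

/-! ### The moment series and the complex moment generating function -/

section moments

variable {μ : Measure ℝ}
theorem integral_pow_eq_normalizedMoment_mul (μ : Measure ℝ) (k : ℕ) :
    ∫ x : ℝ, x ^ k ∂μ = normalizedMoment μ k * k.factorial := by
  rw [normalizedMoment, div_mul_cancel₀ _ (by positivity)]

theorem normalizedMoment_zero [IsProbabilityMeasure μ] : normalizedMoment μ 0 = 1 := by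
  simp [normalizedMoment]

/-- Odd absolute moments are controlled by the neighbouring even ones, through
`|x| ^ (2 * m + 1) ≤ x ^ (2 * m) + x ^ (2 * m + 2)`; passing from `(2 * m + 2)!` to `(2 * m + 1)!`
costs the factor linear in `k`. -/
theorem integral_abs_pow_div_factorial_le (hmom : ∀ k : ℕ, Integrable (fun x : ℝ => x ^ k) μ)
    {M : ℝ} (hM : ∀ k, |normalizedMoment μ k| ≤ M) (k : ℕ) :
    (∫ x : ℝ, |x| ^ k ∂μ) / k.factorial ≤ M * (k + 2) := by
  have hM0 : 0 ≤ M := (abs_nonneg _).trans (hM 0)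
  have hle : ∀ j, normalizedMoment μ j ≤ M := fun j => (le_abs_self _).trans (hM j)
  rcases Nat.even_or_odd' k with ⟨m, rfl | rfl⟩
  · have h : (∫ x : ℝ, |x| ^ (2 * m) ∂μ) / (2 * m).factorial = normalizedMoment μ (2 * m) := by
      simp [normalizedMoment, pow_mul]
    rw [h]
    push_cast
    nlinarith [hle (2 * m), mul_nonneg hM0 (Nat.cast_nonneg (α := ℝ) m)]
  · have hfac : (0 : ℝ) < (2 * m + 1).factorial := by positivity
    have habs : ∀ x : ℝ, |x| ^ (2 * m + 1) ≤ x ^ (2 * m) + x ^ (2 * m + 2) := by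
      intro x
      have h0 : (0 : ℝ) ≤ x ^ (2 * m) := by rw [pow_mul]; positivity
      have h1 : |x| ^ (2 * m) = x ^ (2 * m) := by simp [pow_mul]
      rw [pow_succ, h1, pow_add]
      have h2 : |x| ≤ 1 + x ^ 2 := by nlinarith [sq_nonneg (|x| - 1), sq_abs x, abs_nonneg x]
      nlinarith [mul_le_mul_of_nonneg_left h2 h0]
    have hint : ∫ x : ℝ, |x| ^ (2 * m + 1) ∂μ
        ≤ ∫ x : ℝ, (x ^ (2 * m) + x ^ (2 * m + 2)) ∂μ := by
      refine integral_mono ?_ ((hmom _).add (hmom _)) habs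
      simpa only [norm_pow, Real.norm_eq_abs] using (hmom (2 * m + 1)).norm
    rw [integral_add (hmom _) (hmom _), integral_pow_eq_normalizedMoment_mul,
      integral_pow_eq_normalizedMoment_mul] at hint
    rw [div_le_iff₀ hfac]
    refine hint.trans ?_
    have e1 : normalizedMoment μ (2 * m) * (2 * m).factorial ≤ M * (2 * m + 1).factorial := by
      refine mul_le_mul (hle _) ?_ (by positivity) hM0
      exact_mod_cast Nat.factorial_le (Nat.le_succ _)
    have e2 : normalizedMoment μ (2 * m + 2) * (2 * m + 2).factorial
        ≤ M * ((2 * m + 2) * (2 * m + 1).factorial) := by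
      rw [Nat.factorial_succ (2 * m + 1)]
      push_cast
      have := mul_le_mul_of_nonneg_right (hle (2 * m + 2))
        (show (0 : ℝ) ≤ (2 * m + 2) * (2 * m + 1).factorial by positivity)
      linarith
    refine (add_le_add e1 e2).trans (le_of_eq ?_)
    push_cast
    ring

theorem summable_integral_abs_pow (hmom : ∀ k : ℕ, Integrable (fun x : ℝ => x ^ k) μ)
    {M : ℝ} (hM : ∀ k, |normalizedMoment μ k| ≤ M) {r : ℝ} (hr0 : 0 ≤ r) (hr1 : r < 1) :
    Summable fun k : ℕ => (∫ x : ℝ, |x| ^ k ∂μ) / k.factorial * r ^ k := by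
  have hr : ‖r‖ < 1 := by rwa [Real.norm_of_nonneg hr0]
  have hs : Summable fun k : ℕ => M * ((k : ℝ) ^ 1 * r ^ k) + 2 * M * r ^ k :=
    ((summable_pow_mul_geometric_of_norm_lt_one 1 hr).mul_left M).add
      ((summable_geometric_of_norm_lt_one hr).mul_left (2 * M))
  refine Summable.of_nonneg_of_le (fun k => ?_) (fun k => ?_) hs
  · have : 0 ≤ ∫ x : ℝ, |x| ^ k ∂μ := integral_nonneg fun x => by positivity
    positivity
  · have := mul_le_mul_of_nonneg_right (integral_abs_pow_div_factorial_le hmom hM k)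
      (pow_nonneg hr0 k)
    refine this.trans (le_of_eq (by ring))

theorem integrable_exp_mul [IsProbabilityMeasure μ]
    (hmom : ∀ k : ℕ, Integrable (fun x : ℝ => x ^ k) μ)
    {M : ℝ} (hM : ∀ k, |normalizedMoment μ k| ≤ M) {t : ℝ} (ht : |t| < 1) :
    Integrable (fun x : ℝ => Real.exp (t * x)) μ := by
  have habs : ∀ k : ℕ, Integrable (fun x : ℝ => |x| ^ k) μ := fun k => by
    simpa only [norm_pow, Real.norm_eq_abs] using (hmom k).norm
  let F : ℕ → ℝ → ℝ := fun k x => (|t| * |x|) ^ k / k.factorial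
  have hF : ∀ k x, F k x = |x| ^ k * (|t| ^ k / k.factorial) := fun k x => by
    simp only [F, mul_pow]; ring
  have hFint : ∀ k, Integrable (F k) μ := fun k => by
    rw [show F k = fun x => |x| ^ k * (|t| ^ k / k.factorial) from funext (hF k)]
    exact (habs k).mul_const _
  have hFnonneg : ∀ k x, 0 ≤ F k x := fun k x => by positivity
  have hFval : ∀ k, ∫ x, F k x ∂μ = (∫ x : ℝ, |x| ^ k ∂μ) / k.factorial * |t| ^ k := fun k => by
    simp_rw [hF, integral_mul_const]; ring
  have hFsum : Summable fun k => ∫ x, ‖F k x‖ ∂μ := by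
    simp_rw [Real.norm_of_nonneg (hFnonneg _ _), hFval]
    exact summable_integral_abs_pow hmom hM (abs_nonneg t) ht
  have hsum := hasSum_integral_of_summable_integral_norm hFint hFsum
  have htsum : ∀ x, ∑' k, F k x = Real.exp (|t| * |x|) := fun x => by
    rw [Real.exp_eq_exp_ℝ, NormedSpace.exp_eq_tsum_div]
  simp_rw [htsum] at hsum
  -- The Bochner integral of a non-integrable function is `0`, so positivity of this integral,
  -- read off from the constant term of the series, gives integrability.
  have hpos : 0 < ∫ x, Real.exp (|t| * |x|) ∂μ := by
    have h0 := le_hasSum hsum 0 fun k _ => integral_nonneg (hFnonneg k)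
    have h1 : ∫ x, F 0 x ∂μ = 1 := by simp [F]
    linarith
  have hint : Integrable (fun x : ℝ => Real.exp (|t| * |x|)) μ := by
    by_contra h
    exact hpos.ne' (integral_undef h)
  refine hint.mono' (by fun_prop) (Eventually.of_forall fun x => ?_)
  rw [Real.norm_of_nonneg (Real.exp_pos _).le, ← abs_mul]
  exact Real.exp_le_exp.2 (le_abs_self _)

/-- The normalized moments are the Taylor coefficients at `0` of the complex moment generating
function, and the series converges to it on the whole unit disc. -/
theorem hasSum_normalizedMoment_mul_pow (hmom : ∀ k : ℕ, Integrable (fun x : ℝ => x ^ k) μ)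
    {M : ℝ} (hM : ∀ k, |normalizedMoment μ k| ≤ M) {z : ℂ} (hz : ‖z‖ < 1) :
    HasSum (fun k => (normalizedMoment μ k : ℂ) * z ^ k) (complexMGF id μ z) := by
  let F : ℕ → ℝ → ℂ := fun k x => (z * x) ^ k / k.factorial
  have hF : ∀ k x, F k x = ((x ^ k : ℝ) : ℂ) * (z ^ k / k.factorial) := fun k x => by
    simp only [F, mul_pow, Complex.ofReal_pow]; ring
  have hFint : ∀ k, Integrable (F k) μ := fun k => by
    rw [show F k = fun x => ((x ^ k : ℝ) : ℂ) * (z ^ k / k.factorial) from funext (hF k)]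
    exact (hmom k).ofReal.mul_const _
  have hFsum : Summable fun k => ∫ x, ‖F k x‖ ∂μ := by
    convert summable_integral_abs_pow hmom hM (norm_nonneg z) hz using 2 with k
    have : ∀ x, ‖F k x‖ = |x| ^ k * (‖z‖ ^ k / k.factorial) := fun x => by
      rw [hF]; simp
    simp_rw [this, integral_mul_const]; ring
  have hsum := hasSum_integral_of_summable_integral_norm hFint hFsum
  have htsum : ∀ x, ∑' k, F k x = Complex.exp (z * x) := fun x => by
    rw [Complex.exp_eq_exp_ℂ, NormedSpace.exp_eq_tsum_div]
  simp_rw [htsum] at hsum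
  have hval : (fun k => (normalizedMoment μ k : ℂ) * z ^ k) = fun k => ∫ x, F k x ∂μ := by
    funext k
    simp_rw [hF, integral_mul_const, integral_complex_ofReal]
    rw [normalizedMoment]; push_cast; ring
  rw [hval]
  exact hsum

/-- The moment generating function at `z` is dominated by its value at `z.re`, so the bound blows up
only as `z.re → ±1` and not at the other points of the unit circle. -/
theorem norm_complexMGF_le (hmom : ∀ k : ℕ, Integrable (fun x : ℝ => x ^ k) μ)
    {M : ℝ} (hM : ∀ k, |normalizedMoment μ k| ≤ M) {z : ℂ} (hz : ‖z‖ < 1) :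
    ‖complexMGF id μ z‖ ≤ M * (1 - |z.re|)⁻¹ := by
  have hre : |z.re| < 1 := (Complex.abs_re_le_norm z).trans_lt hz
  have hx : ‖(z.re : ℂ)‖ < 1 := by simpa using hre
  have h1 : ‖complexMGF id μ z‖ ≤ ‖complexMGF id μ (z.re : ℂ)‖ := by
    refine norm_complexMGF_le_mgf.trans ?_
    rw [complexMGF_ofReal, Complex.norm_real]
    exact le_abs_self _
  refine h1.trans ?_
  have hs := hasSum_normalizedMoment_mul_pow hmom hM hx
  rw [← hs.tsum_eq]
  refine tsum_of_norm_bounded ((hasSum_geometric_of_lt_one (abs_nonneg _) hre).mul_left M)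
    fun k => ?_
  rw [norm_mul, norm_pow, Complex.norm_real, Complex.norm_real, Real.norm_eq_abs,
    Real.norm_eq_abs]
  exact mul_le_mul_of_nonneg_right (hM k) (by positivity)

end moments

/-! ### Differences with the sequence shifted by two -/

/-- The Taylor coefficients of `(1 - z ^ 2) * ∑ k, u k * z ^ k`: the sequence `u k - u (k - 2)`,
with the entries of negative index read as `0`. -/
def subShiftTwo (u : ℕ → ℝ) : ℕ → ℝ
  | 0 => u 0
  | 1 => u 1
  | k + 2 => u (k + 2) - u k

theorem abs_subShiftTwo_le {u : ℕ → ℝ} {M : ℝ} (hM : ∀ k, |u k| ≤ M) (k : ℕ) :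
    |subShiftTwo u k| ≤ 2 * M := by
  have hM0 : 0 ≤ M := (abs_nonneg _).trans (hM 0)
  match k with
  | 0 => exact (hM 0).trans (by linarith)
  | 1 => exact (hM 1).trans (by linarith)
  | k + 2 => exact (abs_sub _ _).trans (by linarith [hM (k + 2), hM k])

theorem finite_range_subShiftTwo {u : ℕ → ℝ} (hu : (Set.range u).Finite) :
    (Set.range (subShiftTwo u)).Finite := by
  refine (hu.union (Set.Finite.image2 (· - ·) hu hu)).subset ?_
  rintro _ ⟨k, rfl⟩
  match k with
  | 0 => exact Or.inl ⟨0, rfl⟩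
  | 1 => exact Or.inl ⟨1, rfl⟩
  | k + 2 => exact Or.inr ⟨_, ⟨k + 2, rfl⟩, _, ⟨k, rfl⟩, rfl⟩

theorem hasSum_subShiftTwo {u : ℕ → ℝ} {z S : ℂ} (h : HasSum (fun k => (u k : ℂ) * z ^ k) S) :
    HasSum (fun k => (subShiftTwo u k : ℂ) * z ^ k) ((1 - z ^ 2) * S) := by
  rw [← hasSum_nat_add_iff' 2] at h ⊢
  have h0 : HasSum (fun k => (u k : ℂ) * z ^ k) S := (hasSum_nat_add_iff' 2).1 h
  convert h.sub (h0.mul_left (z ^ 2)) using 1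
  · funext k; simp only [subShiftTwo]; push_cast; ring
  · simp only [Finset.sum_range_succ, Finset.sum_range_zero, subShiftTwo]; ring

/-- The double zeros of `(1 - z ^ 2) ^ 2` at `±1` compensate a singularity of order
`(1 - |z.re|)⁻¹`, because `‖1 ∓ z‖ ^ 2 ≤ 2 * (1 ∓ z.re)` on the unit disc. -/
theorem norm_one_sub_sq_sq_le {z : ℂ} (hz : ‖z‖ < 1) :
    ‖(1 - z ^ 2) * (1 - z ^ 2)‖ ≤ 8 * (1 - |z.re|) := by
  have hre : |z.re| < 1 := (Complex.abs_re_le_norm z).trans_lt hz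
  have hsq : z.re ^ 2 + z.im ^ 2 ≤ 1 := by
    have := Complex.sq_norm z
    rw [Complex.normSq_apply] at this
    nlinarith [norm_nonneg z]
  have e1 : ‖1 - z‖ ^ 2 ≤ 2 * (1 - z.re) := by
    rw [Complex.sq_norm, Complex.normSq_apply]; simp; nlinarith
  have e2 : ‖1 + z‖ ^ 2 ≤ 2 * (1 + z.re) := by
    rw [Complex.sq_norm, Complex.normSq_apply]; simp; nlinarith
  have hb := abs_lt.1 hre
  calc ‖(1 - z ^ 2) * (1 - z ^ 2)‖ = ‖1 - z‖ ^ 2 * ‖1 + z‖ ^ 2 := by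
        rw [← norm_pow, ← norm_pow, ← norm_mul]; ring_nf
    _ ≤ (2 * (1 - z.re)) * (2 * (1 + z.re)) :=
        mul_le_mul e1 e2 (by positivity) (by linarith)
    _ = 4 * ((1 - |z.re|) * (1 + |z.re|)) := by
        rw [show (1 - |z.re|) * (1 + |z.re|) = 1 - |z.re| ^ 2 by ring, sq_abs]; ring
    _ ≤ _ := by nlinarith [abs_nonneg z.re]

/-- A bounded sequence that is eventually arithmetic along each parity class is eventually constant
along each of them. -/
theorem eq_of_second_difference_eq_zero {u : ℕ → ℝ} {M : ℝ}
    (hM : ∀ k, |u k| ≤ M) {K : ℕ}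
    (hK : ∀ k, K ≤ k → u (k + 4) - u (k + 2) = u (k + 2) - u k) :
    ∀ k, K ≤ k → u (k + 2) = u k := by
  intro k hk
  have hd : ∀ n : ℕ, u (k + 2 * n + 2) - u (k + 2 * n) = u (k + 2) - u k := by
    intro n
    induction n with
    | zero => rfl
    | succ n ih => rw [← ih, ← hK (k + 2 * n) (by omega)]; rfl
  have hlin : ∀ n : ℕ, u (k + 2 * n) = u k + n * (u (k + 2) - u k) := by
    intro n
    induction n with
    | zero => simp
    | succ n ih =>
      have := hd n
      rw [show k + 2 * (n + 1) = k + 2 * n + 2 by ring]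
      push_cast
      linarith
  by_contra hne
  have hpos : 0 < |u (k + 2) - u k| := abs_pos.2 (sub_ne_zero.2 hne)
  obtain ⟨n, hn⟩ := exists_nat_gt (2 * M / |u (k + 2) - u k|)
  rw [div_lt_iff₀ hpos] at hn
  have h1 : n * |u (k + 2) - u k| = |u (k + 2 * n) - u k| := by
    rw [hlin n, add_sub_cancel_left, abs_mul, Nat.abs_cast]
  have h2 := abs_sub (u (k + 2 * n)) (u k)
  linarith [hM (k + 2 * n), hM k]

/-! ### Distributions with finitely many normalized moments -/

section finitelyManyMoments

variable {μ : Measure ℝ}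

/-- If the normalized moments take finitely many values, they are eventually 2-periodic: the Taylor
coefficients of the bounded function `(1 - z ^ 2) ^ 2 * complexMGF id μ z` tend to `0` and take
finitely many values. -/
theorem exists_normalizedMoment_add_two_eq (hmom : ∀ k : ℕ, Integrable (fun x : ℝ => x ^ k) μ)
    (hfin : (Set.range (normalizedMoment μ)).Finite) {M : ℝ}
    (hM : ∀ k, |normalizedMoment μ k| ≤ M) :
    ∃ K, ∀ k, K ≤ k → normalizedMoment μ (k + 2) = normalizedMoment μ k := by
  set h : ℕ → ℝ := subShiftTwo (subShiftTwo (normalizedMoment μ)) with hh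
  have hM0 : 0 ≤ M := (abs_nonneg _).trans (hM 0)
  have hhM : ∀ k, |h k| ≤ 2 * (2 * M) := abs_subShiftTwo_le (abs_subShiftTwo_le hM)
  have htend : Tendsto (fun k => (h k : ℂ)) atTop (𝓝 0) := by
    refine tendsto_zero_of_norm_sum_le (C := 8 * M) (fun r hr0 hr1 => ?_) fun z hz => ?_
    · refine Summable.of_nonneg_of_le (fun k => by positivity) (fun k => ?_)
        ((summable_geometric_of_lt_one hr0 hr1).mul_left (2 * (2 * M)))
      rw [Complex.norm_real]
      exact mul_le_mul_of_nonneg_right (hhM k) (by positivity)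
    · have hs := hasSum_subShiftTwo (hasSum_subShiftTwo
        (hasSum_normalizedMoment_mul_pow hmom hM hz))
      rw [hs.tsum_eq, ← mul_assoc, norm_mul]
      have hre : 0 < 1 - |z.re| := sub_pos.2 ((Complex.abs_re_le_norm z).trans_lt hz)
      calc _ ≤ 8 * (1 - |z.re|) * (M * (1 - |z.re|)⁻¹) :=
            mul_le_mul (norm_one_sub_sq_sq_le hz) (norm_complexMGF_le hmom hM hz)
              (norm_nonneg _) (by positivity)
        _ = 8 * M := by field_simp
  have hhfin : (Set.range fun k => (h k : ℂ)).Finite := by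
    have := (finite_range_subShiftTwo (finite_range_subShiftTwo hfin)).image ((↑) : ℝ → ℂ)
    rwa [← Set.range_comp] at this
  obtain ⟨K, hK⟩ := eventually_atTop.1 (eventually_eq_zero_of_finite_range hhfin htend)
  refine ⟨K, eq_of_second_difference_eq_zero hM fun k hk => ?_⟩
  have h0 : h (k + 4) = 0 := by exact_mod_cast hK (k + 4) (by omega)
  have h1 : h (k + 4) = (normalizedMoment μ (k + 4) - normalizedMoment μ (k + 2))
      - (normalizedMoment μ (k + 2) - normalizedMoment μ k) := rfl
  linarith

/-- If `(1 - z ^ 2) * complexMGF id μ z` has a polynomial `P` as Taylor series at `0`, then it equals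
`P` on the whole strip `|z.re| < 1`, in particular on the imaginary axis. -/
theorem one_sub_sq_mul_complexMGF [IsProbabilityMeasure μ]
    (hmom : ∀ k : ℕ, Integrable (fun x : ℝ => x ^ k) μ) {M : ℝ}
    (hM : ∀ k, |normalizedMoment μ k| ≤ M) {P : ℂ[X]}
    (hP : ∀ k, P.coeff k = subShiftTwo (normalizedMoment μ) k) {z : ℂ} (hz : |z.re| < 1) :
    (1 - z ^ 2) * complexMGF id μ z = P.eval z := by
  let U : Set ℂ := {w | w.re ∈ Set.Ioo (-1 : ℝ) 1}
  have hUsub : U ⊆ {w | w.re ∈ interior (integrableExpSet id μ)} := by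
    intro w hw
    refine interior_maximal (fun t ht => ?_) isOpen_Ioo hw
    exact integrable_exp_mul hmom hM (abs_lt.2 ht)
  have hF : AnalyticOnNhd ℂ (fun w => (1 - w ^ 2) * complexMGF id μ w) U := by
    refine AnalyticOnNhd.mul (fun w _ => ?_) (analyticOnNhd_complexMGF.mono hUsub)
    fun_prop
  have hPa : AnalyticOnNhd ℂ (fun w => P.eval w) U := fun w _ =>
    (P.differentiable.analyticAt w)
  have hU : IsPreconnected U :=
    ((convex_Ioo (-1 : ℝ) 1).linear_preimage Complex.reLm).isPreconnected
  refine hF.eqOn_of_preconnected_of_eventuallyEq hPa hU (z₀ := 0) (by simp [U]) ?_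
    (abs_lt.1 hz)
  filter_upwards [Metric.ball_mem_nhds (0 : ℂ) one_pos] with w hw
  rw [mem_ball_zero_iff] at hw
  have hs := hasSum_subShiftTwo (hasSum_normalizedMoment_mul_pow hmom hM hw)
  refine hs.unique ?_
  rw [eval_eq_sum_range]
  simp_rw [← hP]
  refine hasSum_sum_of_ne_finset_zero fun k hk => ?_
  rw [coeff_eq_zero_of_natDegree_lt (by simpa using hk), zero_mul]

/-- Periodicity starts at index `1`: the polynomial `(1 - z ^ 2) * complexMGF id μ z` is at most
`1 + t ^ 2` in absolute value at `z = i * t`, since the characteristic function is bounded by `1`. -/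
theorem normalizedMoment_add_three_eq [IsProbabilityMeasure μ]
    (hmom : ∀ k : ℕ, Integrable (fun x : ℝ => x ^ k) μ)
    (hfin : (Set.range (normalizedMoment μ)).Finite) {M : ℝ}
    (hM : ∀ k, |normalizedMoment μ k| ≤ M) (k : ℕ) :
    normalizedMoment μ (k + 3) = normalizedMoment μ (k + 1) := by
  obtain ⟨K, hK⟩ := exists_normalizedMoment_add_two_eq hmom hfin hM
  let P : ℂ[X] := ∑ n ∈ Finset.range (K + 2),
    monomial n (subShiftTwo (normalizedMoment μ) n : ℂ)
  have hP : ∀ k, P.coeff k = subShiftTwo (normalizedMoment μ) k := by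
    intro k
    have h0 : K + 2 ≤ k → subShiftTwo (normalizedMoment μ) k = 0 := by
      intro hk
      obtain ⟨j, rfl⟩ := Nat.exists_eq_add_of_le' (show 2 ≤ k by omega)
      exact sub_eq_zero.2 (hK j (by omega))
    simp only [P, finsetSum_coeff, coeff_monomial, Finset.sum_ite_eq', Finset.mem_range]
    split_ifs with hk
    · rfl
    · rw [h0 (not_lt.1 hk), Complex.ofReal_zero]
  have hbound : ∀ t : ℝ, ‖P.eval ((t : ℂ) * Complex.I)‖ ≤ 1 + t ^ 2 := by
    intro t
    rw [← one_sub_sq_mul_complexMGF hmom hM hP (by simp), complexMGF_id_mul_I, norm_mul]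
    have h1 : (1 - ((t : ℂ) * Complex.I) ^ 2) = ((1 + t ^ 2 : ℝ) : ℂ) := by
      rw [mul_pow, Complex.I_sq]; push_cast; ring
    rw [h1, Complex.norm_real, Real.norm_of_nonneg (by positivity)]
    exact mul_le_of_le_one_right (by positivity) (norm_charFun_le_one t)
  have := coeff_eq_zero_of_norm_eval_mul_I_le hbound (k + 3) (by omega)
  rw [hP, Complex.ofReal_eq_zero] at this
  exact sub_eq_zero.1 this

/-- A limit of a characteristic function at infinity is nonnegative (it is the mass of `{0}`). -/
theorem nonneg_of_tendsto_charFun [IsProbabilityMeasure μ] {b : ℝ}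
    (hb : Tendsto (charFun μ) atTop (𝓝 (b : ℂ))) :
    0 ≤ b := by
  let g : ℝ → ℝ := fun t => ∫ x, Real.cos (t * x) ∂μ
  have hint : ∀ t : ℝ, Integrable (fun x => Real.cos (t * x)) μ := fun t =>
    Integrable.of_bound (by fun_prop) 1 (Eventually.of_forall fun x => Real.abs_cos_le_one _)
  have hre : ∀ t, (charFun μ t).re = g t := by
    intro t
    rw [charFun_apply_real]
    have hI : Integrable (fun x : ℝ => Complex.exp (t * x * Complex.I)) μ :=
      Integrable.of_bound (by fun_prop) 1 (Eventually.of_forall fun x => by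
        rw [← Complex.ofReal_mul, Complex.norm_exp_ofReal_mul_I])
    have h := integral_re hI
    simp only [RCLike.re_eq_complex_re] at h
    rw [← h]
    refine integral_congr_ae (Eventually.of_forall fun x => ?_)
    simp only
    rw [← Complex.ofReal_mul, Complex.exp_ofReal_mul_I_re]
  have hg : Tendsto g atTop (𝓝 b) := by
    have := (Complex.continuous_re.tendsto _).comp hb
    simpa only [Function.comp_def, hre, Complex.ofReal_re] using this
  have hgneg : ∀ t, g (-t) = g t := fun t => by simp [g]
  -- Positive definiteness of the characteristic function at the points `0, T, …, (n - 1) * T`.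
  have hpos : ∀ (n : ℕ) (T : ℝ),
      0 ≤ ∑ j ∈ Finset.range n, ∑ k ∈ Finset.range n, g (((j : ℝ) - k) * T) := by
    intro n T
    have h1 : ∑ j ∈ Finset.range n, ∑ k ∈ Finset.range n, g (((j : ℝ) - k) * T)
        = ∫ x, ∑ j ∈ Finset.range n, ∑ k ∈ Finset.range n,
            Real.cos (((j : ℝ) - k) * T * x) ∂μ := by
      rw [integral_finsetSum _ fun j _ => integrable_finsetSum _ fun k _ => hint _]
      refine Finset.sum_congr rfl fun j _ => ?_
      rw [integral_finsetSum _ fun k _ => hint _]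
    rw [h1]
    refine integral_nonneg fun x => ?_
    have h2 : ∑ j ∈ Finset.range n, ∑ k ∈ Finset.range n, Real.cos (((j : ℝ) - k) * T * x)
        = (∑ j ∈ Finset.range n, Real.cos (j * T * x)) ^ 2
          + (∑ j ∈ Finset.range n, Real.sin (j * T * x)) ^ 2 := by
      simp only [sq, Finset.sum_mul_sum, ← Finset.sum_add_distrib, sub_mul, Real.cos_sub]
    simp only [h2, Pi.zero_apply]
    positivity
  -- As `T → ∞`, the diagonal terms stay `1` and the others tend to `b`.
  have hlim : ∀ n : ℕ, 0 ≤ (n : ℝ) + (n * n - n) * b := by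
    intro n
    have hterm : ∀ j k : ℕ, Tendsto (fun T : ℝ => g (((j : ℝ) - k) * T)) atTop
        (𝓝 (b + if j = k then 1 - b else 0)) := by
      intro j k
      rcases lt_trichotomy j k with h | rfl | h
      · have hjk : (0 : ℝ) < k - j := sub_pos.2 (by exact_mod_cast h)
        have := hg.comp (tendsto_id.const_mul_atTop hjk)
        simp only [if_neg h.ne, add_zero]
        refine this.congr fun T => ?_
        simp only [Function.comp_apply, id]
        rw [← hgneg]; ring_nf
      · simp [g]
      · have hjk : (0 : ℝ) < j - k := sub_pos.2 (by exact_mod_cast h)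
        simp only [if_neg h.ne', add_zero]
        exact hg.comp (tendsto_id.const_mul_atTop hjk)
    have := ge_of_tendsto' (tendsto_finsetSum (Finset.range n) fun j _ =>
      tendsto_finsetSum (Finset.range n) fun k _ => hterm j k) (hpos n)
    refine this.trans (le_of_eq ?_)
    simp only [Finset.sum_add_distrib, Finset.sum_const, Finset.card_range, nsmul_eq_mul,
      Finset.sum_ite_eq, Finset.mem_range]
    rw [Finset.sum_congr rfl fun j hj => if_pos (Finset.mem_range.1 hj)]
    simp only [Finset.sum_const, Finset.card_range, nsmul_eq_mul]
    ring
  by_contra hneg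
  push Not at hneg
  obtain ⟨n, hn⟩ := exists_nat_gt (1 + 1 / (-b))
  have hb' : 0 < -b := by linarith
  have h1 : 1 < (n - 1) * (-b) := by
    rw [← div_lt_iff₀ hb']; linarith
  have hn0 : (0 : ℝ) < n := by
    have : 0 < 1 / (-b) := by positivity
    linarith
  nlinarith [hlim n]

end finitelyManyMoments

end auxiliary

open Filter Topology Polynomial in
theorem theorem1 (μ : Measure ℝ) [IsProbabilityMeasure μ]
    (hnondeg : ∀ c : ℝ, μ ≠ Measure.dirac c)
    (hmom : ∀ k : ℕ, Integrable (fun x : ℝ => x ^ k) μ) :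
    (Set.range (normalizedMoment μ)).Infinite ∨
      ((Set.range (normalizedMoment μ)).encard ≤ 3 ∧
        ∃ a b : ℝ, 0 ≤ b ∧ 0 ≤ (1 - a - b) / 2 ∧ 0 ≤ (1 + a - b) / 2 ∧
          normalizedMoment μ 0 = 1 ∧
          (∀ k : ℕ, normalizedMoment μ (2 * k + 1) = a) ∧
          (∀ k : ℕ, normalizedMoment μ (2 * k + 2) = 1 - b) ∧
          ∀ t : ℝ, charFun μ t =
            (1 + Complex.I * (a : ℂ) * (t : ℂ) + (b : ℂ) * (t : ℂ) ^ 2) / (1 + (t : ℂ) ^ 2)) := by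
  rw [or_iff_not_imp_left, Set.not_infinite]
  intro hfin
  obtain ⟨M, hM⟩ : ∃ M, ∀ k, |normalizedMoment μ k| ≤ M := by
    obtain ⟨M, hM⟩ := (hfin.image (|·|)).bddAbove
    exact ⟨M, fun k => hM ⟨_, ⟨k, rfl⟩, rfl⟩⟩
  have hper := normalizedMoment_add_three_eq hmom hfin hM
  set a := normalizedMoment μ 1 with ha
  set b := 1 - normalizedMoment μ 2 with hb
  have hodd : ∀ k : ℕ, normalizedMoment μ (2 * k + 1) = a := by
    intro k
    induction k with
    | zero => rfl
    | succ k ih => rw [← ih]; exact hper (2 * k)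
  have heven : ∀ k : ℕ, normalizedMoment μ (2 * k + 2) = 1 - b := by
    intro k
    induction k with
    | zero => rw [hb, sub_sub_cancel]
    | succ k ih => rw [← ih]; exact hper (2 * k + 1)
  have hmgf : ∀ z : ℂ, |z.re| < 1 → (1 - z ^ 2) * complexMGF id μ z = 1 + a * z - b * z ^ 2 := by
    intro z hz
    have hP : ∀ k, (1 + C (a : ℂ) * X - C (b : ℂ) * X ^ 2 : ℂ[X]).coeff k
        = ((subShiftTwo (normalizedMoment μ) k : ℝ) : ℂ) := by
      intro k
      match k with
      | 0 => simp [subShiftTwo, normalizedMoment_zero]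
      | 1 => simp [subShiftTwo, ← ha, coeff_X_pow, coeff_one]
      | 2 =>
        have h2 : normalizedMoment μ 2 = 1 - b := heven 0
        simp [subShiftTwo, normalizedMoment_zero, h2, coeff_one]
      | k + 3 =>
        simp only [subShiftTwo, hper k]
        simp [coeff_one]
    rw [one_sub_sq_mul_complexMGF hmom hM hP hz]
    simp
  have hchar : ∀ t : ℝ, charFun μ t =
      (1 + Complex.I * (a : ℂ) * (t : ℂ) + (b : ℂ) * (t : ℂ) ^ 2) / (1 + (t : ℂ) ^ 2) := by
    intro t
    have hne : (1 + (t : ℂ) ^ 2) ≠ 0 := by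
      exact_mod_cast (show (1 + t ^ 2 : ℝ) ≠ 0 by positivity)
    have h := hmgf ((t : ℂ) * Complex.I) (by simp)
    rw [complexMGF_id_mul_I, mul_pow, Complex.I_sq] at h
    rw [eq_div_iff hne]
    linear_combination h
  -- On the real segment the moment generating function is nonnegative; the endpoints `±1` of the
  -- segment, where it has poles, give the two sign conditions on `a` and `b`.
  have hreal : ∀ x : ℝ, |x| < 1 → 0 ≤ 1 + a * x - b * x ^ 2 := by
    intro x hx
    have h := hmgf (x : ℂ) (by simpa using hx)
    rw [complexMGF_ofReal] at h
    have h' : (1 - x ^ 2) * mgf id μ x = 1 + a * x - b * x ^ 2 := by exact_mod_cast h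
    rw [← h']
    have : x ^ 2 ≤ 1 := by rw [← sq_abs]; nlinarith [abs_nonneg x]
    exact mul_nonneg (by linarith) mgf_nonneg
  have hclosed : ∀ x ∈ Set.Icc (-1 : ℝ) 1, 0 ≤ 1 + a * x - b * x ^ 2 := by
    have hcl : IsClosed {x : ℝ | 0 ≤ 1 + a * x - b * x ^ 2} :=
      isClosed_le continuous_const (by fun_prop)
    intro x hx
    rw [← closure_Ioo (by norm_num)] at hx
    exact closure_minimal (fun y hy => hreal y (abs_lt.2 hy)) hcl hx
  have hb0 : 0 ≤ b := by
    refine nonneg_of_tendsto_charFun (μ := μ) ?_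
    have hinv : Tendsto (fun t : ℝ => ((t : ℂ))⁻¹) atTop (𝓝 0) := by
      simpa [Function.comp_def] using
        (Complex.continuous_ofReal.tendsto 0).comp tendsto_inv_atTop_zero
    have hlim : Tendsto (fun t : ℝ => (((t : ℂ))⁻¹ ^ 2 + Complex.I * a * ((t : ℂ))⁻¹ + b)
        / (((t : ℂ))⁻¹ ^ 2 + 1)) atTop (𝓝 (b : ℂ)) := by
      have := (((hinv.pow 2).add (hinv.const_mul (Complex.I * a))).add_const (b : ℂ)).div
        ((hinv.pow 2).add_const 1) (by simp)
      simpa [Pi.div_def] using this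
    refine hlim.congr' ?_
    filter_upwards [eventually_gt_atTop 0] with t ht
    have ht' : (t : ℂ) ≠ 0 := by exact_mod_cast ht.ne'
    have hne : (1 + (t : ℂ) ^ 2) ≠ 0 := by
      exact_mod_cast (show (1 + t ^ 2 : ℝ) ≠ 0 by positivity)
    rw [hchar]
    field_simp
  refine ⟨?_, a, b, hb0, ?_, ?_, normalizedMoment_zero, hodd, heven, hchar⟩
  · have hsub : Set.range (normalizedMoment μ) ⊆ {1, a, 1 - b} := by
      rintro _ ⟨k, rfl⟩
      rcases k with _ | k
      · simp [normalizedMoment_zero]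
      · rcases Nat.even_or_odd' k with ⟨m, rfl | rfl⟩
        · simp [hodd m]
        · simp [heven m]
    refine (Set.encard_le_encard hsub).trans ?_
    refine (Set.encard_insert_le _ _).trans ?_
    refine (add_le_add_left (Set.encard_insert_le _ _) 1).trans ?_
    rw [Set.encard_singleton]; norm_num
  · linarith [hclosed (-1) (by norm_num)]
  · linarith [hclosed 1 (by norm_num)]
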